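/- Let $\mathcal G$ be a weighted digraph on the nodes $v_1,\dots,v_n$ with adjacency matrix $A=[a_{ij}]$, where $a_{ij}\ge 0$, $a_{ii}=0$, and there is an edge from $v_j$ to $v_i$ if and only if $a_{ij}>0$. Let $L=\operatorname{diag}\bigl(\sum_{j}a_{1j},\dots,\sum_j a_{nj}\bigr)-A$ be its Laplacian. Suppose that $\mathcal G$ contains a directed spanning tree, that is, a root $r$ and a subset of the edges such that no edge of the subset enters $r$, exactly one enters every other node, and every node can be reached from $r$ along a directed path in the subset. Let $\Delta>0$, let $\mathtt q^s(z)=\bigl\lfloor \tfrac z\Delta+\tfrac12\bigr\rfloor\Delta$ be the symmetric uniform quantizer, and let $q^s(x)=(\mathtt q^s(x_1),\dots,\mathtt q^s(x_n))^\top$ for $x\in\mathbb R^n$. Consider the system $$\dot x=-L\,q^s(x).$$ For $X:\mathbb R^n\to\mathbb R^n$ put $\mathcal F[X](x)=\bigcap_{\delta>0}\bigcap_{\mu(S)=0}\overline{\mathrm{co}}\,\{X(B(x,\delta)\setminus S)\}$, where $\mu$ is Lebesgue measure. A Filippov solution on $[0,\infty)$ of $\dot x=X(x)$ is a function $x:[0,\infty)\to\mathbb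 R^n$ that is absolutely continuous on every $[0,t_1]$ and satisfies $\dot x(t)\in\mathcal F[X](x(t))$ for almost every $t\ge 0$. Then every Filippov solution $x:[0,\infty)\to\mathbb R^n$ of $\dot x=-L\,q^s(x)$ converges to practical consensus: with $$\mathcal D_2=\Bigl\{x\in\mathbb R^n \;\Big|\; \exists k\in\mathbb Z \text{ such that } \bigl(k-\tfrac12\bigr)\Delta\le x_i\le\bigl(k+\tfrac12\bigr)\Delta \text{ for all } i=1,\dots,n\Bigr\},$$ the Euclidean distance from $x(t)$ to $\mathcal D_2$ tends to $0$ as $t\to\infty$. -/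

import Mathlib

open Filter Topology MeasureTheory

/-- A weighted digraph on the nodes `Fin n`, given by its adjacency matrix `[a_ij]`:
nonnegative weights and no self-loops. -/
structure WeightedDigraph (n : ℕ) where
  weight : Matrix (Fin n) (Fin n) ℝ
  weight_nonneg : ∀ i j, 0 ≤ weight i j
  weight_self : ∀ i, weight i i = 0

namespace WeightedDigraph

variable {n : ℕ}

/-- There is an edge from node `j` to node `i` if and only if `a_ij > 0`. -/
def Edge (G : WeightedDigraph n) (j i : Fin n) : Prop :=
  0 < G.weight i j

/-- The graph Laplacian: the diagonal matrix of the in-degrees `∑ j, a_ij` minus the adjacency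
matrix. -/
noncomputable def laplacian (G : WeightedDigraph n) : Matrix (Fin n) (Fin n) ℝ :=
  Matrix.diagonal (fun i => ∑ j, G.weight i j) - G.weight

/-- The edge relation `T` is a directed spanning tree of `G` with root `r`: its edges are edges
of `G`, no edge of `T` enters `r`, exactly one edge of `T` enters every other node, and every node
can be reached from `r` along a directed path in `T`. -/
structure IsSpanningTree (G : WeightedDigraph n) (r : Fin n) (T : Fin n → Fin n → Prop) :
    Prop where
  edge : ∀ j i, T j i → G.Edge j i
  root : ∀ j, ¬ T j r
  parent : ∀ i, i ≠ r → ∃! j, T j i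
  reachable : ∀ i, Relation.ReflTransGen T r i

/-- `G` contains a directed spanning tree. -/
def ContainsSpanningTree (G : WeightedDigraph n) : Prop :=
  ∃ (r : Fin n) (T : Fin n → Fin n → Prop), G.IsSpanningTree r T

end WeightedDigraph

/-- The Filippov set-valued map of `X`: the intersection, over all radii `δ > 0` and all Lebesgue
null sets `S`, of the closed convex hull of `X (B(x, δ) \ S)`. -/
def filippovMap {n : ℕ} (X : EuclideanSpace ℝ (Fin n) → EuclideanSpace ℝ (Fin n))
    (x : EuclideanSpace ℝ (Fin n)) : Set (EuclideanSpace ℝ (Fin n)) :=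
  ⋂ (δ : ℝ) (_ : 0 < δ) (S : Set (EuclideanSpace ℝ (Fin n))) (_ : volume S = 0),
    closedConvexHull ℝ (X '' (Metric.ball x δ \ S))

/-- `x` restricted to `[0, t₁]` is a Filippov solution of `x' = X(x)`: it is absolutely continuous
and for almost every `t` in `[0, t₁]` its derivative lies in the Filippov set at `x t`. -/
def IsFilippovSolutionOn {n : ℕ} (X : EuclideanSpace ℝ (Fin n) → EuclideanSpace ℝ (Fin n))
    (t₁ : ℝ) (x : ℝ → EuclideanSpace ℝ (Fin n)) : Prop :=
  AbsolutelyContinuousOnInterval x 0 t₁ ∧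
    ∀ᵐ t ∂(volume.restrict (Set.Icc 0 t₁)), ∃ v ∈ filippovMap X (x t), HasDerivAt x v t

/-- `x` restricted to `[0, ∞)` is a Filippov solution of `x' = X(x)`: its restriction to every
interval `[0, t₁]` is one. The values of `x` at negative times play no role. -/
def IsFilippovSolution {n : ℕ} (X : EuclideanSpace ℝ (Fin n) → EuclideanSpace ℝ (Fin n))
    (x : ℝ → EuclideanSpace ℝ (Fin n)) : Prop :=
  ∀ t₁ : ℝ, 0 < t₁ → IsFilippovSolutionOn X t₁ x

/-- The symmetric uniform quantizer `q^s(z) = ⌊z / Δ + 1 / 2⌋ Δ`. -/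
noncomputable def symmQuantizer (Δ z : ℝ) : ℝ :=
  (⌊z / Δ + 1 / 2⌋ : ℝ) * Δ

/-- The right-hand side `x ↦ -L q^s(x)`, where `q^s` acts on each coordinate. -/
noncomputable def quantizedField {n : ℕ} (G : WeightedDigraph n) (Δ : ℝ)
    (x : EuclideanSpace ℝ (Fin n)) : EuclideanSpace ℝ (Fin n) :=
  WithLp.toLp 2 (-(G.laplacian.mulVec (fun i => symmQuantizer Δ (x i))))

/-- The practical consensus set: all coordinates lie in a common interval
`[(k - 1/2) Δ, (k + 1/2) Δ]` with `k` an integer. -/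
def practicalConsensusSet (n : ℕ) (Δ : ℝ) : Set (EuclideanSpace ℝ (Fin n)) :=
  {x | ∃ k : ℤ, ∀ i, ((k : ℝ) - 1 / 2) * Δ ≤ x i ∧ x i ≤ ((k : ℝ) + 1 / 2) * Δ}

/-! Almost everywhere `x' = -L ν` with `ν` a selection of the set-valued quantizer, and the maximum
of `x` over a set closed under in-neighbours never increases (`le_of_le`). Let `K` be the least
level whose upper cell edge eventually bounds every coordinate. Either `ν ≤ KΔ` from then on, so
that some node stays in cell `K` and a path to it from the root `r` bounds `KΔ - ν r` by a fixed
combination of the `x' i`; or some `ν j` exceeds `KΔ`, which pins `r` and its ancestors at the upper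
edge, so that `ν r ≥ KΔ` afterwards (`exists_level`). The same for `-x` gives a level `K'`. Adding
the two inequalities cancels `ν r`: `(K + K')Δ` is at most the derivative of a linear function of
`x`. Trajectories are bounded, hence `K + K' ≤ 0`, and the two one-sided bounds place all
coordinates in cell `K`. The set is thus reached in finite time. -/

/-! ### Absolutely continuous functions and contact points -/

theorem LipschitzWith.comp_absolutelyContinuousOnInterval {X Y : Type*} [PseudoMetricSpace X]
    [PseudoMetricSpace Y] {K : NNReal} {g : X → Y} (hg : LipschitzWith K g) {f : ℝ → X} {a b : ℝ}
    (hf : AbsolutelyContinuousOnInterval f a b) :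
    AbsolutelyContinuousOnInterval (fun t => g (f t)) a b := by
  refine squeeze_zero (fun E => Finset.sum_nonneg fun i _ => dist_nonneg) (fun E => ?_)
    (by simpa using Tendsto.const_mul (K : ℝ) hf)
  rw [Finset.mul_sum]
  exact Finset.sum_le_sum fun i _ => hg.dist_le_mul _ _

theorem lipschitzWith_finset_sup' {ι : Type*} [Fintype ι] (s : Finset ι) (hs : s.Nonempty) :
    LipschitzWith 1 (fun y : ι → ℝ => s.sup' hs y) := by
  refine LipschitzWith.of_le_add fun y z => Finset.sup'_le hs _ fun i hi => ?_
  have h1 : z i ≤ s.sup' hs z := Finset.le_sup' z hi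
  have h2 := dist_le_pi_dist y z i
  rw [Real.dist_eq] at h2
  linarith [le_abs_self (y i - z i)]

theorem AbsolutelyContinuousOnInterval.mul_sub_le_of_ae_le_deriv {f : ℝ → ℝ} {a b c : ℝ}
    (hf : AbsolutelyContinuousOnInterval f a b) (hab : a ≤ b)
    (h : ∀ᵐ t, t ∈ Set.Ioo a b → ∀ d, HasDerivAt f d t → c ≤ d) :
    c * (b - a) ≤ f b - f a := by
  rw [← hf.integral_deriv_eq_sub]
  have h1 : ∫ _ in a..b, c = c * (b - a) := by simp [mul_comm]
  rw [← h1]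
  refine intervalIntegral.integral_mono_ae_restrict hab intervalIntegrable_const
    hf.intervalIntegrable_deriv ?_
  rw [EventuallyLE, ae_restrict_iff' measurableSet_Icc]
  have hne (p : ℝ) : ∀ᵐ t : ℝ, t ≠ p := by simp [ae_iff, measure_singleton]
  filter_upwards [h, hf.ae_differentiableAt, hne a, hne b] with t h1 h2 ha hb ht
  refine h1 ⟨lt_of_le_of_ne ht.1 ha.symm, lt_of_le_of_ne ht.2 hb⟩ _ (h2 ?_).hasDerivAt
  rwa [Set.uIcc_of_le hab]

theorem AbsolutelyContinuousOnInterval.le_of_ae_deriv_nonpos {f : ℝ → ℝ} {a b : ℝ}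
    (hf : AbsolutelyContinuousOnInterval f a b) (hab : a ≤ b)
    (h : ∀ᵐ t, t ∈ Set.Ioo a b → ∀ d, HasDerivAt f d t → d ≤ 0) : f b ≤ f a := by
  have := hf.neg.mul_sub_le_of_ae_le_deriv (c := 0) hab (by
    filter_upwards [h] with t ht hm d hd
    have := ht hm (-d) (by simpa using hd.neg)
    linarith)
  simp only [Pi.neg_apply] at this
  linarith

/-- Two differentiable functions, one dominating the other, have the same derivative at a
contact point. -/
theorem HasDerivAt.eq_of_le_of_eq {f g : ℝ → ℝ} {f' g' t : ℝ} (hf : HasDerivAt f f' t)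
    (hg : HasDerivAt g g' t) (hle : ∀ᶠ s in 𝓝 t, g s ≤ f s) (heq : f t = g t) : f' = g' := by
  have hmin : IsLocalMin (fun s => f s - g s) t := by
    filter_upwards [hle] with s hs
    linarith
  have := hmin.hasDerivAt_eq_zero (hf.sub hg)
  linarith

/-! ### Selections of the quantizer and monotone bounds -/

/-- `ν` lies between the left and right limits of the symmetric quantizer at `z`. -/
def QuantizerSelection (Δ z ν : ℝ) : Prop :=
  ∀ k : ℤ, (z < ((k : ℝ) + 1 / 2) * Δ → ν ≤ k * Δ) ∧ (((k : ℝ) - 1 / 2) * Δ < z → k * Δ ≤ ν)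

namespace QuantizerSelection

variable {Δ z z' ν ν' : ℝ}

/-- The quantizer rounds ties up and is not odd, but its set-valued version is; this turns every
upper bound into a lower one. -/
theorem neg (h : QuantizerSelection Δ z ν) : QuantizerSelection Δ (-z) (-ν) := by
  intro k
  have h1 := h (-k)
  push_cast at h1
  constructor
  · intro hk
    have := h1.2 (by linarith)
    linarith
  · intro hk
    have := h1.1 (by linarith)
    linarith

/-- The level of the cell of `z` separates `ν` from `ν'`. Strictness is essential: on a cell edge
two selections may differ either way. -/
theorem le_of_lt (hΔ : 0 < Δ) (h : QuantizerSelection Δ z ν) (h' : QuantizerSelection Δ z' ν')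
    (hz : z < z') : ν ≤ ν' := by
  have h1 : z < ((⌊z / Δ + 1 / 2⌋ : ℝ) + 1 / 2) * Δ := by
    rw [← div_lt_iff₀ hΔ]
    linarith [Int.lt_floor_add_one (z / Δ + 1 / 2)]
  have h2 : ((⌊z / Δ + 1 / 2⌋ : ℝ) - 1 / 2) * Δ ≤ z := by
    rw [← le_div_iff₀ hΔ]
    linarith [Int.floor_le (z / Δ + 1 / 2)]
  exact ((h _).1 h1).trans ((h' _).2 (h2.trans_lt hz))

end QuantizerSelection

/-- Coordinatewise form of a Filippov solution of `x' = -L q^s(x)`: almost everywhere,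
`x' = -L ν` for a selection `ν` of the set-valued quantizer. -/
structure IsQuantizedTrajectory {n : ℕ} (G : WeightedDigraph n) (Δ : ℝ) (x ν : ℝ → Fin n → ℝ) :
    Prop where
  absolutelyContinuous : ∀ T, 0 < T → AbsolutelyContinuousOnInterval x 0 T
  ae_selection_hasDerivAt : ∀ᵐ t, 0 < t → ∀ i, QuantizerSelection Δ (x t i) (ν t i) ∧
    HasDerivAt (fun s => x s i) (∑ j, G.weight i j * (ν t j - ν t i)) t

namespace IsQuantizedTrajectory

variable {n : ℕ} {G : WeightedDigraph n} {Δ : ℝ} {x ν : ℝ → Fin n → ℝ}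

theorem neg (h : IsQuantizedTrajectory G Δ x ν) : IsQuantizedTrajectory G Δ (-x) (-ν) where
  absolutelyContinuous T hT := (h.absolutelyContinuous T hT).neg
  ae_selection_hasDerivAt := by
    filter_upwards [h.ae_selection_hasDerivAt] with t ht h0 i
    refine ⟨(ht h0 i).1.neg, ?_⟩
    have h1 : ∑ j, G.weight i j * ((-ν) t j - (-ν) t i) =
        -∑ j, G.weight i j * (ν t j - ν t i) := by
      rw [← Finset.sum_neg_distrib]
      refine Finset.sum_congr rfl fun j _ => ?_
      simp only [Pi.neg_apply]
      ring
    rw [h1]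
    exact (ht h0 i).2.neg

theorem absolutelyContinuousOnInterval (h : IsQuantizedTrajectory G Δ x ν) {s t : ℝ} (hs : 0 ≤ s)
    (hst : s ≤ t) : AbsolutelyContinuousOnInterval x s t := by
  refine (h.absolutelyContinuous (t + 1) (by linarith)).mono ?_
  rw [Set.uIcc_of_le hst, Set.uIcc_of_le (by linarith)]
  exact Set.Icc_subset_Icc hs (by linarith)

theorem absolutelyContinuousOnInterval_apply (h : IsQuantizedTrajectory G Δ x ν) {s t : ℝ}
    (hs : 0 ≤ s) (hst : s ≤ t) (i : Fin n) :
    AbsolutelyContinuousOnInterval (fun u => x u i) s t :=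
  LipschitzWith.comp_absolutelyContinuousOnInterval (g := fun y : Fin n → ℝ => y i)
    (LipschitzWith.eval i) (h.absolutelyContinuousOnInterval hs hst)

/-- An upper bound on a set of nodes closed under in-neighbours persists. -/
theorem le_of_le (h : IsQuantizedTrajectory G Δ x ν) (hΔ : 0 < Δ) {C : Finset (Fin n)}
    (hC : ∀ i ∈ C, ∀ j, G.Edge j i → j ∈ C) {s t c : ℝ} (hs : 0 ≤ s) (hst : s ≤ t)
    (hc : ∀ i ∈ C, x s i ≤ c) : ∀ i ∈ C, x t i ≤ c := by
  intro i₀ hi₀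
  have hne : C.Nonempty := ⟨i₀, hi₀⟩
  refine (Finset.le_sup' (x t) hi₀).trans (le_trans ?_ (Finset.sup'_le hne _ hc))
  refine AbsolutelyContinuousOnInterval.le_of_ae_deriv_nonpos
    (f := fun u => C.sup' hne (x u))
    ((lipschitzWith_finset_sup' C hne).comp_absolutelyContinuousOnInterval
      (h.absolutelyContinuousOnInterval hs hst)) hst ?_
  filter_upwards [h.ae_selection_hasDerivAt] with u hu hmem d hd
  replace hu := hu (hs.trans_lt hmem.1)
  -- Ties in `x` do not order `ν`, so among the maximisers of `x` one with the largest `ν` is taken.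
  obtain ⟨i, hi, hmax⟩ := C.exists_max_image (fun i => toLex (x u i, ν u i)) hne
  have hmax' : ∀ j ∈ C, x u j < x u i ∨ x u j = x u i ∧ ν u j ≤ ν u i := fun j hj => by
    simpa [Prod.Lex.toLex_le_toLex] using hmax j hj
  have hd' := hd.eq_of_le_of_eq (hu i).2
    (Eventually.of_forall fun s => Finset.le_sup' (x s) hi)
    (le_antisymm (Finset.sup'_le hne _ fun j hj => by
      rcases hmax' j hj with h1 | h1
      exacts [h1.le, h1.1.le]) (Finset.le_sup' (x u) hi))
  rw [hd']
  refine Finset.sum_nonpos fun j _ => ?_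
  rcases (G.weight_nonneg i j).eq_or_lt with h0 | h0
  · simp [← h0]
  · have : ν u j ≤ ν u i := by
      rcases hmax' j (hC i hi j h0) with h1 | h1
      exacts [(hu j).1.le_of_lt hΔ (hu i).1 h1, h1.2]
    exact mul_nonpos_of_nonneg_of_nonpos h0.le (by linarith)

theorem ge_of_ge (h : IsQuantizedTrajectory G Δ x ν) (hΔ : 0 < Δ) {C : Finset (Fin n)}
    (hC : ∀ i ∈ C, ∀ j, G.Edge j i → j ∈ C) {s t c : ℝ} (hs : 0 ≤ s) (hst : s ≤ t)
    (hc : ∀ i ∈ C, c ≤ x s i) : ∀ i ∈ C, c ≤ x t i := fun i hi =>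
  neg_le_neg_iff.1 (h.neg.le_of_le hΔ hC (c := -c) hs hst
    (fun i hi => neg_le_neg (hc i hi)) i hi)

/-- While no selected value exceeds level `K`, no node enters the cell of `K` from below. -/
theorem le_of_le_of_ae_le (h : IsQuantizedTrajectory G Δ x ν) {K : ℤ} {T : ℝ} (hT : 0 ≤ T)
    (hν : ∀ᵐ t, T < t → ∀ j, ν t j ≤ K * Δ) {s t : ℝ} (hs : T ≤ s) (hst : s ≤ t) {i : Fin n}
    (hi : x s i ≤ ((K : ℝ) - 1 / 2) * Δ) : x t i ≤ ((K : ℝ) - 1 / 2) * Δ := by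
  set β := ((K : ℝ) - 1 / 2) * Δ with hβ
  rw [← max_eq_right hi]
  refine (le_max_left _ β).trans ?_
  refine AbsolutelyContinuousOnInterval.le_of_ae_deriv_nonpos (f := fun u => max (x u i) β)
    ((LipschitzWith.id.max_const β).comp_absolutelyContinuousOnInterval
      (h.absolutelyContinuousOnInterval_apply (hT.trans hs) hst i)) hst ?_
  filter_upwards [h.ae_selection_hasDerivAt, hν] with u hu hν' hmem d hd
  replace hu := hu ((hT.trans hs).trans_lt hmem.1)
  replace hν' := hν' (hs.trans_lt hmem.1)
  rcases le_or_gt (x u i) β with h1 | h1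
  · exact (hd.eq_of_le_of_eq (hasDerivAt_const u β)
      (Eventually.of_forall fun s => le_max_right _ _) (max_eq_right h1)).le
  · rw [hd.eq_of_le_of_eq (hu i).2 (Eventually.of_forall fun s => le_max_left _ _)
      (max_eq_left h1.le)]
    refine Finset.sum_nonpos fun j _ => mul_nonpos_of_nonneg_of_nonpos (G.weight_nonneg i j) ?_
    linarith [hν' j, ((hu i).1 K).2 h1]

end IsQuantizedTrajectory

/-! ### The root and the limiting level -/

/-- Along a path from `r` to `i₀`, the deficit of `ν` at `r` below a common upper bound attained
at `i₀` is controlled by a fixed linear combination of the coordinates of `-L ν`. -/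
theorem WeightedDigraph.exists_weights_of_reflTransGen {n : ℕ} (G : WeightedDigraph n)
    {r i₀ : Fin n} (h : Relation.ReflTransGen G.Edge r i₀) :
    ∃ w : Fin n → ℝ, ∀ (ν : Fin n → ℝ) (K : ℝ), (∀ j, ν j ≤ K) → ν i₀ = K →
      K - ν r ≤ ∑ i, w i * ∑ j, G.weight i j * (ν j - ν i) := by
  induction h using Relation.ReflTransGen.head_induction_on with
  | refl => exact ⟨0, fun ν K _ h => by simp [h]⟩
  | @head a c hac _ ih =>
    obtain ⟨w, hw⟩ := ih
    replace hac : 0 < G.weight c a := hac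
    -- Row `c` expresses the weighted sum of the deficits `K - ν j` through `K - ν c` and `(-L ν)
    -- c`; all its terms are nonnegative, so the term of `a` alone is bounded by it.
    refine ⟨fun i => ((∑ j, G.weight c j) * w i - if i = c then 1 else 0) / G.weight c a,
      fun ν K hν hK => ?_⟩
    have h1 := mul_le_mul_of_nonneg_left (hw ν K hν hK)
      (Finset.sum_nonneg fun j (_ : j ∈ Finset.univ) => G.weight_nonneg c j)
    have h2 : G.weight c a * (K - ν a) ≤ ∑ j, G.weight c j * (K - ν j) :=
      Finset.single_le_sum (f := fun j => G.weight c j * (K - ν j))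
        (fun j _ => mul_nonneg (G.weight_nonneg c j) (by linarith [hν j])) (Finset.mem_univ a)
    have h3 : ∑ j, G.weight c j * (K - ν j) = (∑ j, G.weight c j) * (K - ν c)
        - ∑ j, G.weight c j * (ν j - ν c) := by
      rw [Finset.sum_mul, ← Finset.sum_sub_distrib]
      exact Finset.sum_congr rfl fun j _ => by ring
    have h4 : ∑ i, ((∑ j, G.weight c j) * w i - if i = c then 1 else 0) / G.weight c a *
        ∑ j, G.weight i j * (ν j - ν i) = ((∑ j, G.weight c j) *
        (∑ i, w i * ∑ j, G.weight i j * (ν j - ν i)) - ∑ j, G.weight c j * (ν j - ν c))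
        / G.weight c a := by
      simp only [div_mul_eq_mul_div, sub_mul, ← Finset.sum_div, Finset.sum_sub_distrib, ite_mul,
        one_mul, zero_mul, Finset.sum_ite_eq', Finset.mem_univ, if_true, mul_assoc,
        ← Finset.mul_sum]
    rw [h4, le_div_iff₀ hac]
    linarith

namespace IsQuantizedTrajectory

variable {n : ℕ} {G : WeightedDigraph n} {Δ : ℝ} {x ν : ℝ → Fin n → ℝ}

theorem exists_forall_le (h : IsQuantizedTrajectory G Δ x ν) (hΔ : 0 < Δ) (r : Fin n) :
    ∃ K : ℤ, (∃ T, 0 ≤ T ∧ ∀ i, x T i ≤ ((K : ℝ) + 1 / 2) * Δ) ∧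
      ∀ T, 0 ≤ T → ∃ i, ((K : ℝ) - 1 / 2) * Δ < x T i := by
  have hbdd : ∃ b : ℤ, ∀ k : ℤ, (∃ T, 0 ≤ T ∧ ∀ i, x T i ≤ ((k : ℝ) + 1 / 2) * Δ) → b ≤ k := by
    obtain ⟨c, hc⟩ := (Set.finite_range (x 0)).bddBelow
    refine ⟨⌊c / Δ - 1 / 2⌋, fun k ⟨T, hT, hk⟩ => ?_⟩
    have h1 := h.ge_of_ge hΔ (C := Finset.univ) (by simp) le_rfl hT
      (fun i _ => hc ⟨i, rfl⟩) r (Finset.mem_univ r)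
    have h2 : c / Δ ≤ (k : ℝ) + 1 / 2 := (div_le_iff₀ hΔ).2 (h1.trans (hk r))
    have h3 : (⌊c / Δ - 1 / 2⌋ : ℝ) ≤ k := (Int.floor_le (c / Δ - 1 / 2)).trans (by linarith)
    exact_mod_cast h3
  have hne : ∃ k : ℤ, ∃ T, 0 ≤ T ∧ ∀ i, x T i ≤ ((k : ℝ) + 1 / 2) * Δ := by
    obtain ⟨c, hc⟩ := (Set.finite_range (x 0)).bddAbove
    refine ⟨⌈c / Δ⌉, 0, le_rfl, fun i => (hc ⟨i, rfl⟩).trans ?_⟩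
    rw [← div_le_iff₀ hΔ]
    linarith [Int.le_ceil (c / Δ)]
  obtain ⟨K, hK, hmin⟩ := Int.exists_least_of_bdd hbdd hne
  refine ⟨K, hK, fun T hT => ?_⟩
  by_contra! hcon
  have := hmin (K - 1) ⟨T, hT, fun i => (hcon i).trans_eq (by push_cast; ring)⟩
  omega

/-- If some selected value exceeds level `K` although all states stay below the top of its cell,
then the root of a spanning tree is at least at level `K` from then on. -/
theorem le_root_of_lt (h : IsQuantizedTrajectory G Δ x ν) (hΔ : 0 < Δ) {r : Fin n}
    (hr : ∀ i, Relation.ReflTransGen G.Edge r i) {K : ℤ} {T t : ℝ} (hT : 0 ≤ T) (hTt : T < t)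
    (hx : ∀ s, T ≤ s → ∀ i, x s i ≤ ((K : ℝ) + 1 / 2) * Δ)
    (ht : ∀ i, QuantizerSelection Δ (x t i) (ν t i) ∧
      HasDerivAt (fun s => x s i) (∑ j, G.weight i j * (ν t j - ν t i)) t)
    (hν : ∃ j, K * Δ < ν t j) : ∀ s, t ≤ s → ((K : ℝ) + 1 / 2) * Δ ≤ x s r := by
  classical
  obtain ⟨j₀, hj₀⟩ := hν
  have : Nonempty (Fin n) := ⟨r⟩
  obtain ⟨m, hm⟩ := Finite.exists_max (ν t)
  have hKm : K * Δ < ν t m := hj₀.trans_le (hm j₀)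
  have htop : ∀ i, ν t i = ν t m → x t i = ((K : ℝ) + 1 / 2) * Δ := fun i hi =>
    le_antisymm (hx t hTt.le i) (not_lt.1 fun hlt => by linarith [((ht i).1 K).1 hlt])
  have hpred : ∀ i j, ν t i = ν t m → G.Edge j i → ν t j = ν t m := by
    intro i j hi hij
    -- The coordinate touches its upper bound at the interior time `t`, so its derivative vanishes;
    -- as `ν t i` is maximal, every summand is then zero.
    have hzero : ∑ l, G.weight i l * (ν t l - ν t i) = 0 :=
      ((hasDerivAt_const t (((K : ℝ) + 1 / 2) * Δ)).eq_of_le_of_eq (ht i).2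
        (by filter_upwards [Ioi_mem_nhds hTt] with s hs using hx s (le_of_lt hs) i)
        (htop i hi).symm).symm
    rw [Finset.sum_eq_zero_iff_of_nonpos fun l _ => mul_nonpos_of_nonneg_of_nonpos
      (G.weight_nonneg i l) (by linarith [hm l])] at hzero
    have hij' : 0 < G.weight i j := hij
    have := (mul_eq_zero.1 (hzero j (Finset.mem_univ j))).resolve_left hij'.ne'
    linarith
  have hanc : ∀ {i j}, Relation.ReflTransGen G.Edge j i → ν t i = ν t m → ν t j = ν t m := by
    intro i j hji hi
    induction hji using Relation.ReflTransGen.head_induction_on with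
    | refl => exact hi
    | head hac _ ih => exact hpred _ _ ih hac
  intro s hs
  -- Edges of `G` outside the tree may enter `r`, so the bound is propagated on all ancestors of
  -- `r`.
  refine h.ge_of_ge hΔ (C := Finset.univ.filter fun i => Relation.ReflTransGen G.Edge i r)
    (fun i hi j hij => ?_) (hT.trans hTt.le) hs (fun i hi => ?_) r
    (Finset.mem_filter.2 ⟨Finset.mem_univ r, .refl⟩)
  · simp only [Finset.mem_filter, Finset.mem_univ, true_and] at hi ⊢
    exact Relation.ReflTransGen.head hij hi
  · simp only [Finset.mem_filter, Finset.mem_univ, true_and] at hi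
    exact (htop i (hanc hi (hanc (hr m) rfl))).ge

/-- Eventually all states lie below the top of the cell of some level `K`, and the deficit of the
root below level `K` is dominated by the derivative of a linear function of the state. -/
theorem exists_level (h : IsQuantizedTrajectory G Δ x ν) (hΔ : 0 < Δ) {r : Fin n}
    (hr : ∀ i, Relation.ReflTransGen G.Edge r i) :
    ∃ (K : ℤ) (T : ℝ) (w : Fin n → ℝ), 0 ≤ T ∧
      (∀ t, T ≤ t → ∀ i, x t i ≤ ((K : ℝ) + 1 / 2) * Δ) ∧
      ∀ᵐ t, T < t → K * Δ - ν t r ≤ ∑ i, w i * ∑ j, G.weight i j * (ν t j - ν t i) := by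
  obtain ⟨K, ⟨T, hT, hKT⟩, hK⟩ := h.exists_forall_le hΔ r
  have hx : ∀ t, T ≤ t → ∀ i, x t i ≤ ((K : ℝ) + 1 / 2) * Δ := fun t ht i =>
    h.le_of_le hΔ (C := Finset.univ) (by simp) hT ht (fun i _ => hKT i) i (Finset.mem_univ i)
  by_cases hν : ∀ᵐ t, T < t → ∀ j, ν t j ≤ K * Δ
  · obtain ⟨i₀, hi₀⟩ : ∃ i, ∀ t, T ≤ t → ((K : ℝ) - 1 / 2) * Δ < x t i := by
      -- Otherwise each node is at some time below cell `K` and remains there; at the latest of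
      -- these times all are below, against the minimality of `K`.
      by_contra! hcon
      choose s hs hxs using hcon
      have : Nonempty (Fin n) := ⟨r⟩
      obtain ⟨m, hm⟩ := Finite.exists_max s
      obtain ⟨i, hi⟩ := hK (s m) (hT.trans (hs m))
      exact hi.not_ge (h.le_of_le_of_ae_le hT hν (hs i) (hm i) (hxs i))
    obtain ⟨w, hw⟩ := G.exists_weights_of_reflTransGen (hr i₀)
    refine ⟨K, T, w, hT, hx, ?_⟩
    filter_upwards [h.ae_selection_hasDerivAt, hν] with t ht hν' hTt
    exact hw (ν t) _ (hν' hTt) (le_antisymm (hν' hTt i₀)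
      (((ht (hT.trans_lt hTt) i₀).1 K).2 (hi₀ t hTt.le)))
  · obtain ⟨t, ht, hTt⟩ := ((not_eventually.1 hν).and_eventually h.ae_selection_hasDerivAt).exists
    push Not at ht
    have hroot := h.le_root_of_lt hΔ hr hT ht.1 hx (hTt (hT.trans_lt ht.1)) ht.2
    refine ⟨K, t, 0, hT.trans ht.1.le, fun s hs => hx s (ht.1.le.trans hs), ?_⟩
    filter_upwards [h.ae_selection_hasDerivAt] with s hs hts
    have := ((hs ((hT.trans_lt ht.1).trans hts) r).1 K).2
      (lt_of_lt_of_le (by nlinarith) (hroot s hts.le))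
    simpa using this

theorem exists_abs_le (h : IsQuantizedTrajectory G Δ x ν) (hΔ : 0 < Δ) :
    ∃ B, ∀ t, 0 ≤ t → ∀ i, |x t i| ≤ B := by
  obtain ⟨B, hB⟩ := (Set.finite_range fun i => |x 0 i|).bddAbove
  have hB' : ∀ i, |x 0 i| ≤ B := fun i => hB ⟨i, rfl⟩
  refine ⟨B, fun t ht i => abs_le.2 ⟨?_, ?_⟩⟩
  · exact h.ge_of_ge hΔ (C := Finset.univ) (by simp) le_rfl ht
      (fun i _ => (abs_le.1 (hB' i)).1) i (Finset.mem_univ i)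
  · exact h.le_of_le hΔ (C := Finset.univ) (by simp) le_rfl ht
      (fun i _ => (abs_le.1 (hB' i)).2) i (Finset.mem_univ i)

/-- A linear function of the state cannot grow at a uniformly positive rate. -/
theorem nonpos_of_ae_le_sum (h : IsQuantizedTrajectory G Δ x ν) (hΔ : 0 < Δ) {T c : ℝ} (hT : 0 ≤ T)
    (w : Fin n → ℝ)
    (hw : ∀ᵐ t, T < t → c ≤ ∑ i, w i * ∑ j, G.weight i j * (ν t j - ν t i)) : c ≤ 0 := by
  obtain ⟨B, hB⟩ := h.exists_abs_le hΔ
  have hbound : ∀ t, 0 ≤ t → |∑ i, w i * x t i| ≤ ∑ i, |w i| * B := fun t ht =>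
    (Finset.abs_sum_le_sum_abs _ _).trans (Finset.sum_le_sum fun i _ => by
      rw [abs_mul]
      exact mul_le_mul_of_nonneg_left (hB t ht i) (abs_nonneg _))
  by_contra! hc
  set D := ∑ i, |w i| * B
  have hD : 0 ≤ D := (abs_nonneg _).trans (hbound 0 le_rfl)
  -- Over this length, growth at rate `c` gives `2D + 1`, more than the oscillation `2D` allowed by
  -- the bound `D`.
  have hlen : 0 < (2 * D + 1) / c := by positivity
  have hTt : T ≤ T + (2 * D + 1) / c := by linarith
  have hac : AbsolutelyContinuousOnInterval (fun t => ∑ i, w i * x t i) T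
      (T + (2 * D + 1) / c) := by
    have hlip := (∑ i, w i • ContinuousLinearMap.proj (R := ℝ) (φ := fun _ : Fin n => ℝ) i).lipschitz
    simpa using hlip.comp_absolutelyContinuousOnInterval (h.absolutelyContinuousOnInterval hT hTt)
  have hgrow := hac.mul_sub_le_of_ae_le_deriv (c := c) hTt (by
    filter_upwards [h.ae_selection_hasDerivAt, hw] with t ht hwt hmem d hd
    rw [hd.unique (HasDerivAt.fun_sum fun i _ =>
      ((ht (hT.trans_lt hmem.1) i).2.const_mul (w i)))]
    exact hwt hmem.1)
  have h1 := (abs_le.1 (hbound T hT)).1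
  have h2 := (abs_le.1 (hbound _ (hT.trans hTt))).2
  have h3 : c * (T + (2 * D + 1) / c - T) = 2 * D + 1 := by
    field_simp
    ring
  linarith

theorem exists_cell (h : IsQuantizedTrajectory G Δ x ν) (hΔ : 0 < Δ) {r : Fin n}
    (hr : ∀ i, Relation.ReflTransGen G.Edge r i) :
    ∃ (k : ℤ) (T : ℝ), ∀ t, T ≤ t → ∀ i,
      ((k : ℝ) - 1 / 2) * Δ ≤ x t i ∧ x t i ≤ ((k : ℝ) + 1 / 2) * Δ := by
  obtain ⟨K, T, w, hT, hx, hw⟩ := h.exists_level hΔ hr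
  obtain ⟨K', T', w', hT', hx', hw'⟩ := h.neg.exists_level hΔ hr
  simp only [Pi.neg_apply] at hx' hw'
  have hle := h.nonpos_of_ae_le_sum (c := (K + K') * Δ) hΔ (hT.trans (le_max_left T T'))
    (w - w') (by
      filter_upwards [hw, hw'] with t h1 h2 ht
      replace h1 := h1 ((le_max_left _ _).trans_lt ht)
      replace h2 := h2 ((le_max_right _ _).trans_lt ht)
      have h3 : ∑ i, (w - w') i * ∑ j, G.weight i j * (ν t j - ν t i) =
          ∑ i, w i * ∑ j, G.weight i j * (ν t j - ν t i) +
          ∑ i, w' i * ∑ j, G.weight i j * (-ν t j - -ν t i) := by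
        rw [← Finset.sum_add_distrib]
        refine Finset.sum_congr rfl fun i _ => ?_
        simp only [Pi.sub_apply, Finset.mul_sum, ← Finset.sum_add_distrib]
        exact Finset.sum_congr rfl fun j _ => by ring
      rw [h3]
      linarith)
  have hKK : (K : ℝ) + K' ≤ 0 := nonpos_of_mul_nonpos_left hle hΔ
  refine ⟨K, max T T', fun t ht i => ⟨?_, hx t ((le_max_left _ _).trans ht) i⟩⟩
  have := hx' t ((le_max_right _ _).trans ht) i
  nlinarith

end IsQuantizedTrajectory

/-! ### From Filippov solutions to selections -/

open Set in
/-- Every element of the Filippov set of `x ↦ -L q^s(x)` is `-L ν` for a selection `ν` of the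
set-valued quantizer. -/
theorem exists_selection_of_mem_filippovMap {n : ℕ} (G : WeightedDigraph n) {Δ : ℝ} (hΔ : 0 < Δ)
    {x v : EuclideanSpace ℝ (Fin n)} (hv : v ∈ filippovMap (quantizedField G Δ) x) :
    ∃ ν : Fin n → ℝ, (∀ i, QuantizerSelection Δ (x i) (ν i)) ∧
      ∀ i, v i = ∑ j, G.weight i j * (ν j - ν i) := by
  -- `lo` and `hi` are the left and right limits of the quantizer at `x i`; near `x` it takes values
  -- only in this box.
  let lo : Fin n → ℝ := fun i => ⌈x i / Δ - 1 / 2⌉ * Δ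
  let hi : Fin n → ℝ := fun i => ⌊x i / Δ + 1 / 2⌋ * Δ
  let A : (Fin n → ℝ) →ₗ[ℝ] EuclideanSpace ℝ (Fin n) :=
    (WithLp.linearEquiv 2 ℝ (Fin n → ℝ)).symm.toLinearMap ∘ₗ (-G.laplacian.mulVecLin)
  have hcont (i : Fin n) :
      Tendsto (fun y : EuclideanSpace ℝ (Fin n) => y i / Δ) (𝓝 x) (𝓝 (x i / Δ)) := by
    apply Continuous.tendsto
    fun_prop
  have hev : ∀ᶠ y in 𝓝 x, (fun i => symmQuantizer Δ (y i)) ∈ Icc lo hi := by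
    have h1 : ∀ᶠ y in 𝓝 x, ∀ i, (⌈x i / Δ - 1 / 2⌉ : ℝ) < y i / Δ + 1 / 2 ∧
        y i / Δ + 1 / 2 < ⌊x i / Δ + 1 / 2⌋ + 1 := by
      refine eventually_all.2 fun i => ?_
      have h2 := (hcont i).add_const (1 / 2)
      exact (h2.eventually_const_lt (by linarith [Int.ceil_lt_add_one (x i / Δ - 1 / 2)])).and
        (h2.eventually_lt_const (Int.lt_floor_add_one _))
    filter_upwards [h1] with y hy
    refine ⟨fun i => mul_le_mul_of_nonneg_right ?_ hΔ.le,
      fun i => mul_le_mul_of_nonneg_right ?_ hΔ.le⟩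
    · exact Int.cast_le.2 (Int.le_floor.2 (hy i).1.le)
    · exact Int.cast_le.2 (Int.lt_add_one_iff.1 (Int.floor_lt.2 (by push_cast; exact (hy i).2)))
  obtain ⟨δ, hδ, hball⟩ := Metric.eventually_nhds_iff_ball.1 hev
  simp only [filippovMap, mem_iInter] at hv
  -- One small ball and the empty null set suffice, since the linear image of the box is already
  -- convex and compact.
  have hsub : closedConvexHull ℝ (quantizedField G Δ '' (Metric.ball x δ \ ∅)) ⊆
      A '' Icc lo hi := by
    refine closedConvexHull_min ?_ ((convex_Icc lo hi).linear_image A)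
      (isCompact_Icc.image A.continuous_of_finiteDimensional).isClosed
    rintro _ ⟨y, hy, rfl⟩
    exact ⟨_, hball y hy.1, rfl⟩
  obtain ⟨ν, hν, rfl⟩ := hsub (hv δ hδ ∅ measure_empty)
  refine ⟨ν, fun i k => ⟨fun hk => (hν.2 i).trans ?_, fun hk => le_trans ?_ (hν.1 i)⟩, fun i => ?_⟩
  · refine mul_le_mul_of_nonneg_right ?_ hΔ.le
    rw [← div_lt_iff₀ hΔ] at hk
    exact Int.cast_le.2 (Int.lt_add_one_iff.1 (Int.floor_lt.2 (by push_cast; linarith)))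
  · refine mul_le_mul_of_nonneg_right ?_ hΔ.le
    rw [← lt_div_iff₀ hΔ] at hk
    exact Int.cast_le.2 (Int.sub_one_lt_iff.1 (Int.lt_ceil.2 (by push_cast; linarith)))
  · change -(G.laplacian.mulVec ν i) = _
    rw [WeightedDigraph.laplacian, Matrix.sub_mulVec, Pi.sub_apply, Matrix.mulVec_diagonal]
    simp only [Matrix.mulVec, dotProduct, mul_sub, Finset.sum_sub_distrib, Finset.sum_mul]
    ring

theorem IsFilippovSolution.exists_isQuantizedTrajectory {n : ℕ} {G : WeightedDigraph n} {Δ : ℝ}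
    (hΔ : 0 < Δ) {x : ℝ → EuclideanSpace ℝ (Fin n)}
    (hx : IsFilippovSolution (quantizedField G Δ) x) :
    ∃ ν, IsQuantizedTrajectory G Δ (fun t i => x t i) ν := by
  have hex : ∀ᵐ t, 0 < t → ∃ ν : Fin n → ℝ, ∀ i, QuantizerSelection Δ (x t i) (ν i) ∧
      HasDerivAt (fun s => x s i) (∑ j, G.weight i j * (ν j - ν i)) t := by
    have hae : ∀ᵐ t, ∀ N : ℕ, t ∈ Set.Icc (0 : ℝ) (N + 1) →
        ∃ v ∈ filippovMap (quantizedField G Δ) (x t), HasDerivAt x v t :=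
      ae_all_iff.2 fun N => (ae_restrict_iff' measurableSet_Icc).1 (hx (N + 1) (by positivity)).2
    filter_upwards [hae] with t ht h0
    obtain ⟨N, hN⟩ := exists_nat_ge t
    obtain ⟨v, hv, hd⟩ := ht N ⟨h0.le, by linarith⟩
    obtain ⟨ν, hν, hvν⟩ := exists_selection_of_mem_filippovMap G hΔ hv
    refine ⟨ν, fun i => ⟨hν i, ?_⟩⟩
    rw [← hvν i]
    exact (EuclideanSpace.proj (𝕜 := ℝ) i).hasFDerivAt.comp_hasDerivAt t hd
  choose! ν hν using fun t (ht : 0 < t → ∃ ν : Fin n → ℝ, ∀ i,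
    QuantizerSelection Δ (x t i) (ν i) ∧
      HasDerivAt (fun s => x s i) (∑ j, G.weight i j * (ν j - ν i)) t) => ht
  exact ⟨ν, fun T hT =>
    (PiLp.lipschitzWith_ofLp 2 fun _ : Fin n => ℝ).comp_absolutelyContinuousOnInterval
    (hx T hT).1, by filter_upwards [hex] with t ht h0 using hν t ht h0⟩

theorem mainTheorem6 {n : ℕ} (G : WeightedDigraph n) (hG : G.ContainsSpanningTree)
    (Δ : ℝ) (hΔ : 0 < Δ) (x : ℝ → EuclideanSpace ℝ (Fin n))
    (hx : IsFilippovSolution (quantizedField G Δ) x) :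
    Tendsto (fun t => Metric.infDist (x t) (practicalConsensusSet n Δ)) atTop (𝓝 0) := by
  obtain ⟨r, T, hT⟩ := hG
  obtain ⟨ν, hν⟩ := hx.exists_isQuantizedTrajectory hΔ
  obtain ⟨k, t₀, hk⟩ := hν.exists_cell hΔ (r := r) fun i =>
    Relation.ReflTransGen.mono hT.edge _ _ (hT.reachable i)
  refine tendsto_const_nhds.congr' ?_
  filter_upwards [eventually_ge_atTop t₀] with t ht
  have hmem : x t ∈ practicalConsensusSet n Δ := ⟨k, hk t ht⟩
  exact (Metric.infDist_zero_of_mem hmem).symm
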